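/- Let $n \ge 1$ and $k \ge 0$ be integers, and for $m \ge 1$ let $\rho(m,k) = \mathbb{E}\big(\tfrac{Y_1+\cdots+Y_m}{\sqrt m}\big)^k$, where $Y_1,\dots,Y_m$ are i.i.d. standard exponential random variables (density $e^{-x}\mathbf 1_{x>0}$). Let $X_1,\dots,X_n$ be i.i.d. standard exponential random variables. All $k$-th moments of $\sum_i a_iX_i$, $a\in\mathbb{R}^n$, are finite, and for all real $a_1,\dots,a_n \ge 0$ with $\sum_{i=1}^n a_i^2 = 1$, $$\mathbb{E}\Big(\sum_{i=1}^n a_i X_i\Big)^k \;\ge\; \min_{1\le m\le n}\rho(m,k).$$ Moreover, the maximum of $\mathbb{E}(\sum_i a_iX_i)^k$ over all such vectors $a$ is attained at a vector with nonzero coordinates of the form $$(s,\underbrace{t,\dots,t}_{n-1}),\qquad 0<t\le s,\quad s^2+(n-1)t^2=1,$$ where $s,t$ depend only on $n$ and $k$ and, if $n \ge 2$, the ratio $x=t/s\in(0,1]$ is a root of the polynomial $$g(x)=k\,\Gamma(n)\Gamma(k)+\sum_{j=0}^{k-2}\Big[\tbinom{k}{j}\Gamma(j+n-1)\Gamma(k-j+1)(n-1)(j-k)+(j+2)\tbinom{k}{j+2}\Gamma(j+n+1)\Gamma(k-j-1)\Big]x^{j+1}-k\,\Gamma(k+n-2)(n-1)\,x^k$$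 (read as the zero polynomial if $k=0$). If $k\ge 1$, every maximizer is, up to a permutation of its coordinates, of this form, with $t/s$ a root of $g$ if $n\ge2$. -/

import Mathlib

open MeasureTheory ProbabilityTheory

noncomputable section

/-- `X` is a finite family of independent standard exponential random variables
(rate `1`, density `exp (-x)` on the positive half-line) on the space `(Ω, μ)`. -/
structure IsIIDStdExp {Ω : Type*} [MeasurableSpace Ω] {n : ℕ}
    (X : Fin n → Ω → ℝ) (μ : Measure Ω) : Prop where
  indep : iIndepFun X μ
  law : ∀ i, HasLaw (X i) (expMeasure 1) μ

/-- The `k`-th moment `E (a₁ X₁ + ⋯ + aₙ Xₙ) ^ k`. -/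
def linMoment {Ω : Type*} [MeasurableSpace Ω] {n : ℕ}
    (X : Fin n → Ω → ℝ) (μ : Measure Ω) (k : ℕ) (a : Fin n → ℝ) : ℝ :=
  ∫ ω, (∑ i, a i * X i ω) ^ k ∂μ

/-- `ρ(m, k)`: the `k`-th moment of `(X₁ + ⋯ + Xₘ) / √m`, where `X₁, …, Xₘ` are the coordinates
on the product of `m` copies of the standard exponential distribution. -/
def rho (m k : ℕ) : ℝ :=
  ∫ x : Fin m → ℝ, ((∑ i, x i) / √(m : ℝ)) ^ k ∂(Measure.pi fun _ : Fin m => expMeasure 1)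

/-- The non-negative part of the Euclidean unit sphere of `ℝⁿ`. -/
def nonnegSphere (n : ℕ) : Set (Fin n → ℝ) :=
  {a | (∀ i, 0 ≤ a i) ∧ ∑ i, a i ^ 2 = 1}

/-- The vector `(s, t, …, t)` with `n - 1` entries `t`. -/
def headVec (n : ℕ) (s t : ℝ) : Fin n → ℝ :=
  fun i => if (i : ℕ) = 0 then s else t

open Polynomial in
/-- The explicit polynomial (for `n ≥ 2`) one of whose roots is the ratio `t / s`:
`k Γ(n) Γ(k) + ∑_{j=0}^{k-2} [ C(k,j) Γ(j+n-1) Γ(k-j+1) (n-1) (j-k)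
  + (j+2) C(k,j+2) Γ(j+n+1) Γ(k-j-1) ] x^(j+1) - k Γ(k+n-2) (n-1) x^k`. -/
def ratioPoly (n k : ℕ) : ℝ[X] :=
  C ((k : ℝ) * Real.Gamma n * Real.Gamma k)
    + ∑ j ∈ Finset.range (k - 1),
        C ((k.choose j : ℝ) * Real.Gamma ((j : ℝ) + n - 1) * Real.Gamma ((k : ℝ) - j + 1)
              * ((n : ℝ) - 1) * ((j : ℝ) - k)
            + ((j : ℝ) + 2) * (k.choose (j + 2) : ℝ) * Real.Gamma ((j : ℝ) + n + 1)
              * Real.Gamma ((k : ℝ) - j - 1)) * X ^ (j + 1)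
    - C ((k : ℝ) * Real.Gamma ((k : ℝ) + n - 2) * ((n : ℝ) - 1)) * X ^ k

/-- The pair `(s, t)` satisfies `0 < t ≤ s`, the vector `(s, t, …, t)` of length `n` has norm `1`
and, as soon as the entry `t` occurs in it, `t / s` is a root of the explicit polynomial. -/
structure IsMaxPair (n k : ℕ) (s t : ℝ) : Prop where
  pos : 0 < t
  le : t ≤ s
  norm_eq : s ^ 2 + ((n : ℝ) - 1) * t ^ 2 = 1
  root : 2 ≤ n → (ratioPoly n k).IsRoot (t / s)

end

open PowerSeries Filter Topology

/-- The geometric series `∑ aʲ Xʲ = 1 / (1 - a X)`. -/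
noncomputable def geomSeries (a : ℝ) : PowerSeries ℝ := PowerSeries.mk fun j => a ^ j

/-- The complete homogeneous symmetric polynomial of degree `k` in the entries of `a`. -/
noncomputable def completeHomog {n : ℕ} (a : Fin n → ℝ) (k : ℕ) : ℝ :=
  coeff k (∏ i, geomSeries (a i))

@[simp] lemma coeff_geomSeries (a : ℝ) (j : ℕ) : coeff j (geomSeries a) = a ^ j := by
  simp [geomSeries]

@[simp] lemma geomSeries_zero : geomSeries 0 = 1 := by
  ext j
  simp [coeff_one, zero_pow_eq]

lemma one_sub_mul_geomSeries (a : ℝ) : (1 - C a * X) * geomSeries a = 1 := by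
  ext j
  rw [sub_mul, one_mul, mul_assoc, map_sub, coeff_C_mul]
  cases j with
  | zero => rw [coeff_zero_X_mul]; simp [geomSeries]
  | succ j => rw [coeff_succ_X_mul]; simp [coeff_one, pow_succ, mul_comm]

lemma coeff_succ_geomSeries_mul (a : ℝ) (F : PowerSeries ℝ) (j : ℕ) :
    coeff (j + 1) (geomSeries a * F) = coeff (j + 1) F + a * coeff j (geomSeries a * F) := by
  have h : geomSeries a * F = F + C a * (X * (geomSeries a * F)) := by
    linear_combination F * one_sub_mul_geomSeries a
  conv_lhs => rw [h]
  simp [coeff_succ_X_mul]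

/-- All coefficients are nonnegative. -/
def CoeffNonneg (F : PowerSeries ℝ) : Prop := ∀ j, 0 ≤ coeff j F

lemma CoeffNonneg.mul {F G : PowerSeries ℝ} (hF : CoeffNonneg F) (hG : CoeffNonneg G) :
    CoeffNonneg (F * G) := fun j => by
  rw [coeff_mul]
  exact Finset.sum_nonneg fun p _ => mul_nonneg (hF _) (hG _)

lemma coeffNonneg_one : CoeffNonneg 1 := fun j => by
  rw [coeff_one]; split_ifs <;> norm_num

lemma coeffNonneg_prod {ι : Type*} (s : Finset ι) (F : ι → PowerSeries ℝ)
    (h : ∀ i ∈ s, CoeffNonneg (F i)) : CoeffNonneg (∏ i ∈ s, F i) :=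
  Finset.prod_induction F CoeffNonneg (fun _ _ => CoeffNonneg.mul) coeffNonneg_one h

lemma coeffNonneg_geomSeries {a : ℝ} (ha : 0 ≤ a) : CoeffNonneg (geomSeries a) := fun j => by
  simpa using pow_nonneg ha j

lemma CoeffNonneg.coeff_mul_le {F F' G : PowerSeries ℝ} (hG : CoeffNonneg G)
    (h : ∀ j, coeff j F ≤ coeff j F') (j : ℕ) : coeff j (F * G) ≤ coeff j (F' * G) := by
  rw [coeff_mul, coeff_mul]
  exact Finset.sum_le_sum fun p _ => mul_le_mul_of_nonneg_right (h _) (hG _)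

lemma CoeffNonneg.coeff_mul_constantCoeff_le {F G : PowerSeries ℝ} (hF : CoeffNonneg F)
    (hG : CoeffNonneg G) (j : ℕ) : coeff j F * coeff 0 G ≤ coeff j (F * G) := by
  rw [coeff_mul]
  exact Finset.single_le_sum (f := fun p : ℕ × ℕ => coeff p.1 F * coeff p.2 G)
    (fun p _ => mul_nonneg (hF _) (hG _)) (a := (j, 0)) (by simp)

lemma coeff_zero_prod_geomSeries {ι : Type*} (s : Finset ι) (a : ι → ℝ) :
    coeff 0 (∏ i ∈ s, geomSeries (a i)) = 1 := by
  rw [coeff_zero_eq_constantCoeff_apply, map_prod]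
  refine Finset.prod_eq_one fun i _ => ?_
  rw [← coeff_zero_eq_constantCoeff_apply]; simp

lemma coeff_prod_geomSeries_pos {ι : Type*} [DecidableEq ι] {s : Finset ι} {a : ι → ℝ}
    (ha : ∀ i ∈ s, 0 ≤ a i)
    {i : ι} (hi : i ∈ s) (hpos : 0 < a i) (j : ℕ) : 0 < coeff j (∏ i ∈ s, geomSeries (a i)) := by
  rw [← Finset.mul_prod_erase s _ hi]
  have h := CoeffNonneg.coeff_mul_constantCoeff_le (coeffNonneg_geomSeries hpos.le)
    (coeffNonneg_prod (s.erase i) (fun i => geomSeries (a i))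
      fun l hl => coeffNonneg_geomSeries (ha l (Finset.mem_of_mem_erase hl))) j
  rw [coeff_zero_prod_geomSeries, mul_one, coeff_geomSeries] at h
  exact (pow_pos hpos j).trans_le h

/-- All coefficients depend continuously on the parameter. -/
def CoeffContinuous {T : Type*} [TopologicalSpace T] (F : T → PowerSeries ℝ) : Prop :=
  ∀ j, Continuous fun y => coeff j (F y)

section
variable {T : Type*} [TopologicalSpace T]

lemma CoeffContinuous.mul {F G : T → PowerSeries ℝ} (hF : CoeffContinuous F)
    (hG : CoeffContinuous G) : CoeffContinuous fun y => F y * G y := fun j => by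
  simp only [coeff_mul]
  exact continuous_finsetSum _ fun p _ => (hF _).mul (hG _)

lemma CoeffContinuous.sub {F G : T → PowerSeries ℝ} (hF : CoeffContinuous F)
    (hG : CoeffContinuous G) : CoeffContinuous fun y => F y - G y := fun j => by
  simp only [map_sub]
  exact (hF _).sub (hG _)

lemma coeffContinuous_const (F : PowerSeries ℝ) : CoeffContinuous fun _ : T => F :=
  fun _ => continuous_const

lemma coeffContinuous_geomSeries {f : T → ℝ} (hf : Continuous f) :
    CoeffContinuous fun y => geomSeries (f y) := fun j => by
  simp only [coeff_geomSeries]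
  exact hf.pow j

lemma coeffContinuous_C {f : T → ℝ} (hf : Continuous f) :
    CoeffContinuous fun y => C (f y) := fun j => by
  simp only [coeff_C]
  split_ifs
  exacts [hf, continuous_const]

lemma coeffContinuous_prod {ι : Type*} [DecidableEq ι] (s : Finset ι) (F : ι → T → PowerSeries ℝ)
    (h : ∀ i ∈ s, CoeffContinuous (F i)) : CoeffContinuous fun y => ∏ i ∈ s, F i y := by
  induction s using Finset.induction_on with
  | empty => simpa using coeffContinuous_const 1
  | insert i s hi ih =>
    simp only [Finset.prod_insert hi]
    exact (h i (Finset.mem_insert_self _ _)).mul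
      (ih fun l hl => h l (Finset.mem_insert_of_mem hl))
end

lemma continuous_completeHomog (n k : ℕ) : Continuous fun a : Fin n → ℝ => completeHomog a k :=
  coeffContinuous_prod Finset.univ (fun i (a : Fin n → ℝ) => geomSeries (a i))
    (fun i _ => coeffContinuous_geomSeries (continuous_apply i)) k

/-- The term `x y X² / ((1 - x X) (1 - y X)) * G` whose coefficients are compared with those of `G`
in the first-order conditions for an extremum on the sphere. -/
noncomputable def pairTerm (G : PowerSeries ℝ) (x y : ℝ) : PowerSeries ℝ :=
  C (x * y) * (X ^ 2 * (geomSeries x * geomSeries y * G))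

lemma pairTerm_comm (G : PowerSeries ℝ) (x y : ℝ) : pairTerm G x y = pairTerm G y x := by
  simp only [pairTerm, mul_comm x y, mul_comm (geomSeries x)]

lemma one_sub_add_mul_geomSeries (a b : ℝ) (G : PowerSeries ℝ) :
    (1 - C (a + b) * X) * (geomSeries a * geomSeries b * G) = G - pairTerm G a b := by
  have ha := one_sub_mul_geomSeries a
  have hb := one_sub_mul_geomSeries b
  simp only [pairTerm, map_add, map_mul]
  linear_combination G * (1 - C b * X) * geomSeries b * ha + G * hb

lemma geomSeries_pair_sub {a b x y : ℝ} (h : x ^ 2 + y ^ 2 = a ^ 2 + b ^ 2) :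
    geomSeries a * geomSeries b - geomSeries x * geomSeries y
      = C (a + b - (x + y)) * (X * ((1 - C ((a + b + (x + y)) / 2) * X) *
          (geomSeries a * geomSeries b * (geomSeries x * geomSeries y)))) := by
  have ha := one_sub_mul_geomSeries a
  have hb := one_sub_mul_geomSeries b
  have hx := one_sub_mul_geomSeries x
  have hy := one_sub_mul_geomSeries y
  have hc : C (a * b - x * y) = C ((a + b - (x + y)) * ((a + b + (x + y)) / 2)) := by
    congr 1; linear_combination h / 2
  have e1 : geomSeries a * geomSeries b = geomSeries a * geomSeries b *
      (geomSeries x * geomSeries y) * ((1 - C x * X) * (1 - C y * X)) := by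
    linear_combination -geomSeries a * geomSeries b * (hx * ((1 - C y * X) * geomSeries y) + hy)
  have e2 : geomSeries x * geomSeries y = geomSeries a * geomSeries b *
      (geomSeries x * geomSeries y) * ((1 - C a * X) * (1 - C b * X)) := by
    linear_combination -geomSeries x * geomSeries y * (ha * ((1 - C b * X) * geomSeries b) + hb)
  have e3 : (1 - C x * X) * (1 - C y * X) - (1 - C a * X) * (1 - C b * X)
      = C (a + b - (x + y)) * (X * (1 - C ((a + b + (x + y)) / 2) * X)) := by
    rw [map_mul] at hc
    simp only [map_sub, map_mul, map_add] at hc ⊢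
    linear_combination -X ^ 2 * hc
  linear_combination e1 - e2 + geomSeries a * geomSeries b * (geomSeries x * geomSeries y) * e3

lemma pair_first_order {R : PowerSeries ℝ} {a b : ℝ} (hb : 0 ≤ b) (hba : b ≤ a)
    (ε : ℝ) (K : ℕ)
    (H : ∀ x y, 0 ≤ x → 0 ≤ y → x ^ 2 + y ^ 2 = a ^ 2 + b ^ 2 →
      0 ≤ ε * (coeff (K + 1) (geomSeries a * geomSeries b * R)
        - coeff (K + 1) (geomSeries x * geomSeries y * R))) :
    (0 < b → 0 ≤ ε * coeff K (geomSeries a * geomSeries b * R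
        - pairTerm (geomSeries a * geomSeries b * R) a b)) ∧
    (b < a → ε * coeff K (geomSeries a * geomSeries b * R
        - pairTerm (geomSeries a * geomSeries b * R) a b) ≤ 0) := by
  set c := a ^ 2 + b ^ 2 with hc
  let A : ℝ → ℝ := fun v => (v + √(2 * c - v ^ 2)) / 2
  let B : ℝ → ℝ := fun v => (v - √(2 * c - v ^ 2)) / 2
  have hsq : √(2 * c - (a + b) ^ 2) = a - b := by
    rw [show 2 * c - (a + b) ^ 2 = (a - b) ^ 2 by rw [hc]; ring]
    exact Real.sqrt_sq (by linarith)
  have hA : A (a + b) = a := by simp only [A, hsq]; ring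
  have hB : B (a + b) = b := by simp only [B, hsq]; ring
  let Φ : ℝ → ℝ := fun v => ε * coeff K ((1 - C ((a + b + v) / 2) * X) *
    (geomSeries a * geomSeries b * (geomSeries (A v) * geomSeries (B v)) * R))
  have hAc : Continuous A := by fun_prop
  have hBc : Continuous B := by fun_prop
  have hΦc : Continuous Φ := by
    refine continuous_const.mul ((CoeffContinuous.mul ?_ ?_) K)
    · exact (coeffContinuous_const 1).sub
        ((coeffContinuous_C (by fun_prop)).mul (coeffContinuous_const X))
    · exact ((coeffContinuous_const _).mul ((coeffContinuous_geomSeries hAc).mul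
        (coeffContinuous_geomSeries hBc))).mul (coeffContinuous_const _)
  have hΦ : Φ (a + b) = ε * coeff K (geomSeries a * geomSeries b * R
        - pairTerm (geomSeries a * geomSeries b * R) a b) := by
    simp only [Φ, hA, hB]
    rw [← one_sub_add_mul_geomSeries, show (a + b + (a + b)) / 2 = a + b by ring]
    congr 3
    ring
  have key : ∀ v, 0 < v → c ≤ v ^ 2 → v ^ 2 ≤ 2 * c → 0 ≤ (a + b - v) * Φ v := by
    intro v hv h1 h2
    have hs : √(2 * c - v ^ 2) ^ 2 = 2 * c - v ^ 2 := Real.sq_sqrt (by linarith)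
    have hs0 := Real.sqrt_nonneg (2 * c - v ^ 2)
    have hle : √(2 * c - v ^ 2) ≤ v := Real.sqrt_le_iff.mpr ⟨hv.le, by linarith⟩
    have hAB : A v ^ 2 + B v ^ 2 = c := by simp only [A, B]; linear_combination hs / 2
    have hsum : A v + B v = v := by simp only [A, B]; ring
    have := H (A v) (B v) (by simp only [A]; linarith) (by simp only [B]; linarith) hAB
    rw [← map_sub, ← sub_mul, geomSeries_pair_sub (hAB.trans hc), hsum] at this
    have e : coeff (K + 1) (C (a + b - v) * (X * ((1 - C ((a + b + v) / 2) * X) *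
          (geomSeries a * geomSeries b * (geomSeries (A v) * geomSeries (B v))))) * R)
        = (a + b - v) * coeff K ((1 - C ((a + b + v) / 2) * X) *
    (geomSeries a * geomSeries b * (geomSeries (A v) * geomSeries (B v)) * R)) := by
      simp only [mul_assoc]
      rw [coeff_C_mul, coeff_succ_X_mul]
    rw [e] at this
    simp only [Φ]
    linarith
  have hcont : ∀ s : Set ℝ, Tendsto Φ (𝓝[s] (a + b)) (𝓝 (Φ (a + b))) := fun s =>
    hΦc.continuousAt.mono_left nhdsWithin_le_nhds
  rw [← hΦ]
  constructor
  · intro hb0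
    have hlt : c < (a + b) ^ 2 := by rw [hc]; nlinarith
    refine ge_of_tendsto (hcont (Set.Iio (a + b))) ?_
    have h1 : ∀ᶠ v in 𝓝[<] (a + b), c < v ^ 2 :=
      (((continuous_pow 2).tendsto (a + b)).eventually_const_lt hlt).filter_mono nhdsWithin_le_nhds
    have h2 : ∀ᶠ v in 𝓝[<] (a + b), 0 < v :=
      (eventually_gt_nhds (by linarith)).filter_mono nhdsWithin_le_nhds
    filter_upwards [h1, h2, self_mem_nhdsWithin] with v hv1 hv2 hv3
    have hv3 : v < a + b := hv3
    have := key v hv2 hv1.le (by rw [hc]; nlinarith [sq_nonneg (a - b)])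
    exact nonneg_of_mul_nonneg_right this (by linarith)
  · intro hlt
    have hlt2 : (a + b) ^ 2 < 2 * c := by rw [hc]; nlinarith [sq_pos_of_pos (sub_pos.mpr hlt)]
    refine le_of_tendsto (hcont (Set.Ioi (a + b))) ?_
    have h1 : ∀ᶠ v in 𝓝[>] (a + b), v ^ 2 < 2 * c :=
      (((continuous_pow 2).tendsto (a + b)).eventually_lt_const hlt2).filter_mono nhdsWithin_le_nhds
    filter_upwards [h1, self_mem_nhdsWithin] with v hv1 hv3
    have hv3 : a + b < v := hv3
    have := key v (by linarith) (by rw [hc]; nlinarith) hv1.le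
    by_contra! hcon
    nlinarith [mul_pos (sub_pos.mpr hv3) hcon]

lemma coeff_pairTerm_lt {G : PowerSeries ℝ} (hG : CoeffNonneg G) {x y y' : ℝ} (hx : 0 < x)
    (hy : 0 < y) (hyy : y < y') {K : ℕ} (h : 0 < coeff K (pairTerm G x y)) :
    coeff K (pairTerm G x y) < coeff K (pairTerm G x y') := by
  have hle : coeff K (X ^ 2 * (geomSeries x * geomSeries y * G))
      ≤ coeff K (X ^ 2 * (geomSeries x * geomSeries y' * G)) := by
    have hN : CoeffNonneg (X ^ 2 * (geomSeries x * G)) := by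
      refine CoeffNonneg.mul (fun j => ?_) ((coeffNonneg_geomSeries hx.le).mul hG)
      rw [coeff_X_pow]; split_ifs <;> norm_num
    have := hN.coeff_mul_le (F := geomSeries y) (F' := geomSeries y')
      (fun j => by simpa using pow_le_pow_left₀ hy.le hyy.le j) K
    convert this using 2 <;> ring
  have hy0 := hy.trans hyy
  simp only [pairTerm, coeff_C_mul] at h ⊢
  have hpos := pos_of_mul_pos_right h (mul_pos hx hy).le
  calc x * y * _ < x * y' * coeff K (X ^ 2 * (geomSeries x * geomSeries y * G)) := by gcongr
    _ ≤ _ := by gcongr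

/-- First-order conditions at an extremum: `ε = 1` for a maximum, `ε = -1` for a minimum. -/
lemma first_order_of_extremum {n : ℕ} {a : Fin n → ℝ} (ha : a ∈ nonnegSphere n) (ε : ℝ) (K : ℕ)
    (H : ∀ b ∈ nonnegSphere n, 0 ≤ ε * (completeHomog a (K + 1) - completeHomog b (K + 1)))
    {i j : Fin n} (hij : i ≠ j) :
    (0 < a i → 0 < a j → 0 ≤ ε * coeff K ((∏ l, geomSeries (a l))
      - pairTerm (∏ l, geomSeries (a l)) (a i) (a j))) ∧
    (a i ≠ a j → ε * coeff K ((∏ l, geomSeries (a l))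
      - pairTerm (∏ l, geomSeries (a l)) (a i) (a j)) ≤ 0) := by
  wlog hle : a j ≤ a i generalizing i j
  · have := this hij.symm (le_of_not_ge hle)
    rw [pairTerm_comm]
    exact ⟨fun h1 h2 => this.1 h2 h1, fun h => this.2 h.symm⟩
  have hj : j ∈ Finset.univ.erase i := by simp [hij.symm]
  have split : ∀ {M : Type} [CommMonoid M] (f : Fin n → M),
      ∏ l, f l = f i * f j * ∏ l ∈ (Finset.univ.erase i).erase j, f l := by
    intro M _ f
    rw [← Finset.mul_prod_erase _ _ (Finset.mem_univ i), ← Finset.mul_prod_erase _ _ hj, mul_assoc]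
  have splits : ∀ (f : Fin n → ℝ),
      ∑ l, f l = f i + f j + ∑ l ∈ (Finset.univ.erase i).erase j, f l := by
    intro f
    rw [← Finset.add_sum_erase _ _ (Finset.mem_univ i), ← Finset.add_sum_erase _ _ hj, add_assoc]
  rw [split fun l => geomSeries (a l)]
  have main := pair_first_order
    (R := ∏ l ∈ (Finset.univ.erase i).erase j, geomSeries (a l)) (ha.1 j) hle ε K ?_
  · exact ⟨fun _ h => main.1 h, fun h => main.2 (lt_of_le_of_ne hle h.symm)⟩
  intro x y hx hy hxy
  let b : Fin n → ℝ := fun l => if l = i then x else if l = j then y else a l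
  have hbi : b i = x := by simp [b]
  have hbj : b j = y := by simp [b, hij.symm]
  have hbl : ∀ l ∈ (Finset.univ.erase i).erase j, b l = a l := by
    intro l hl
    simp only [Finset.mem_erase, Finset.mem_univ, and_true] at hl
    simp [b, hl.1, hl.2]
  have hb : b ∈ nonnegSphere n := by
    refine ⟨fun l => ?_, ?_⟩
    · simp only [b]; split_ifs
      exacts [hx, hy, ha.1 l]
    · rw [splits, hbi, hbj, hxy, Finset.sum_congr rfl fun l hl => by rw [hbl l hl],
        ← splits fun l => a l ^ 2]
      exact ha.2
  have := H b hb
  rw [completeHomog, completeHomog, split fun l => geomSeries (a l),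
    split fun l => geomSeries (b l), hbi, hbj,
    Finset.prod_congr rfl fun l hl => congrArg geomSeries (hbl l hl)] at this
  exact this

lemma exists_pos_of_mem_nonnegSphere {n : ℕ} {a : Fin n → ℝ} (ha : a ∈ nonnegSphere n) :
    ∃ i, 0 < a i := by
  by_contra! h
  have : ∑ i, a i ^ 2 = 0 := Finset.sum_eq_zero fun i _ => by
    rw [le_antisymm (h i) (ha.1 i)]; norm_num
  linarith [ha.2]

lemma completeHomog_comp_perm {n : ℕ} (a : Fin n → ℝ) (σ : Equiv.Perm (Fin n)) (k : ℕ) :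
    completeHomog (a ∘ σ) k = completeHomog a k := by
  simp only [completeHomog, Function.comp]
  rw [Equiv.prod_comp σ fun i => geomSeries (a i)]

lemma mem_nonnegSphere_comp_perm {n : ℕ} {a : Fin n → ℝ} (σ : Equiv.Perm (Fin n))
    (h : a ∘ σ ∈ nonnegSphere n) : a ∈ nonnegSphere n := by
  refine ⟨fun i => by simpa using h.1 (σ.symm i), ?_⟩
  have := h.2
  simp only [Function.comp] at this
  rwa [Equiv.sum_comp σ fun i => a i ^ 2] at this

/-- A maximizer has all its entries positive, and all but the largest one are equal. -/
lemma shape_of_max {n K : ℕ} {a : Fin n → ℝ} (ha : a ∈ nonnegSphere n)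
    (H : ∀ b ∈ nonnegSphere n, completeHomog b (K + 1) ≤ completeHomog a (K + 1)) :
    ∃ (i : Fin n) (t : ℝ), 0 < t ∧ t ≤ a i ∧ (∀ j, j ≠ i → a j = t) ∧
      (∀ j, j ≠ i → coeff K (pairTerm (∏ l, geomSeries (a l)) (a i) (a j))
        = coeff K (∏ l, geomSeries (a l)) ∨ a i = a j) := by
  obtain ⟨p, hp⟩ := exists_pos_of_mem_nonnegSphere ha
  have hC : 0 < coeff K (∏ l, geomSeries (a l)) :=
    coeff_prod_geomSeries_pos (fun i _ => ha.1 i) (Finset.mem_univ p) hp K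
  have fo := fun {i j : Fin n} (hij : i ≠ j) =>
    first_order_of_extremum ha 1 K (fun b hb => by linarith [H b hb]) hij
  simp only [one_mul, map_sub] at fo
  have hpos : ∀ i, 0 < a i := by
    intro i
    refine lt_of_le_of_ne (ha.1 i) fun h0 => ?_
    have hne : a i ≠ a p := by rw [← h0]; exact hp.ne
    have := (fo (i := i) (j := p) (fun h => hne (h ▸ rfl))).2 hne
    rw [← h0] at this
    simp only [pairTerm, zero_mul, map_zero] at this
    linarith
  have hle : ∀ {i j}, i ≠ j → coeff K (pairTerm (∏ l, geomSeries (a l)) (a i) (a j))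
      ≤ coeff K (∏ l, geomSeries (a l)) := fun hij => by
    linarith [(fo hij).1 (hpos _) (hpos _)]
  have heq : ∀ {i j}, a i ≠ a j → coeff K (pairTerm (∏ l, geomSeries (a l)) (a i) (a j))
      = coeff K (∏ l, geomSeries (a l)) := fun {i j} hne => by
    have hij : i ≠ j := fun h => hne (h ▸ rfl)
    linarith [hle hij, (fo hij).2 hne]
  have hG : CoeffNonneg (∏ l, geomSeries (a l)) :=
    coeffNonneg_prod _ _ fun i _ => coeffNonneg_geomSeries (ha.1 i)
  have hinj : ∀ {i j l}, a i ≠ a j → a i ≠ a l → a j = a l := by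
    intro i j l h1 h2
    by_contra h3
    rcases lt_or_gt_of_ne h3 with h | h
    · have := coeff_pairTerm_lt hG (hpos i) (hpos j) h (K := K) (by rw [heq h1]; exact hC)
      rw [heq h1, heq h2] at this
      exact lt_irrefl _ this
    · have := coeff_pairTerm_lt hG (hpos i) (hpos l) h (K := K) (by rw [heq h2]; exact hC)
      rw [heq h1, heq h2] at this
      exact lt_irrefl _ this
  have : Nonempty (Fin n) := ⟨p⟩
  obtain ⟨i, hi⟩ := Finite.exists_max a
  by_cases hdup : ∃ j, j ≠ i ∧ a j = a i
  · obtain ⟨j, hji, haj⟩ := hdup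
    have hall : ∀ l, a l = a i := by
      intro l
      by_contra hl
      have hlt := lt_of_le_of_ne (hi l) hl
      have h1 := heq (i := i) (j := l) (Ne.symm hl)
      have h2 := coeff_pairTerm_lt hG (hpos i) (hpos l) hlt (K := K) (by rw [h1]; exact hC)
      have h3 := hle hji.symm
      rw [haj] at h3
      linarith
    exact ⟨i, a i, hpos i, le_rfl, fun l _ => hall l, fun l _ => Or.inr (hall l).symm⟩
  · push Not at hdup
    by_cases hex : ∃ j, j ≠ i
    · obtain ⟨j, hj⟩ := hex
      exact ⟨i, a j, hpos j, hi j, fun l hl => hinj (hdup l hl).symm (hdup j hj).symm,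
        fun l hl => Or.inl (heq (hdup l hl).symm)⟩
    · push Not at hex
      exact ⟨i, a i, hpos i, le_rfl, fun j hj => absurd (hex j) hj, fun j hj => absurd (hex j) hj⟩

/-- The nonzero entries of a minimizer are all equal, or they are a single `t` and copies of some
`s > t` for which the first-order condition holds. -/
lemma shape_of_min {n K : ℕ} {a : Fin n → ℝ} (ha : a ∈ nonnegSphere n)
    (H : ∀ b ∈ nonnegSphere n, completeHomog a (K + 1) ≤ completeHomog b (K + 1)) :
    (∃ c, 0 < c ∧ ∀ i, a i ≠ 0 → a i = c) ∨
    ∃ (i : Fin n) (s : ℝ), 0 < a i ∧ a i < s ∧ (∃ j, a j = s) ∧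
      (∀ j, j ≠ i → a j ≠ 0 → a j = s) ∧
      coeff K (pairTerm (∏ l, geomSeries (a l)) s (a i)) = coeff K (∏ l, geomSeries (a l)) := by
  obtain ⟨p, hp⟩ := exists_pos_of_mem_nonnegSphere ha
  have hC : 0 < coeff K (∏ l, geomSeries (a l)) :=
    coeff_prod_geomSeries_pos (fun i _ => ha.1 i) (Finset.mem_univ p) hp K
  have fo := fun {i j : Fin n} (hij : i ≠ j) =>
    first_order_of_extremum ha (-1) K (fun b hb => by linarith [H b hb]) hij
  simp only [map_sub] at fo
  have hle : ∀ {i j}, i ≠ j → 0 < a i → 0 < a j → coeff K (∏ l, geomSeries (a l)) ≤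
      coeff K (pairTerm (∏ l, geomSeries (a l)) (a i) (a j)) := fun hij h1 h2 => by
    linarith [(fo hij).1 h1 h2]
  have heq : ∀ {i j}, 0 < a i → 0 < a j → a i ≠ a j →
      coeff K (pairTerm (∏ l, geomSeries (a l)) (a i) (a j))
      = coeff K (∏ l, geomSeries (a l)) := fun {i j} h1 h2 hne => by
    have hij : i ≠ j := fun h => hne (h ▸ rfl)
    linarith [hle hij h1 h2, (fo hij).2 hne]
  have hG : CoeffNonneg (∏ l, geomSeries (a l)) :=
    coeffNonneg_prod _ _ fun i _ => coeffNonneg_geomSeries (ha.1 i)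
  obtain ⟨i, hi, hmin⟩ := Finset.exists_min_image (Finset.univ.filter fun i => 0 < a i) a
    ⟨p, by simpa using hp⟩
  simp only [Finset.mem_filter, Finset.mem_univ, true_and] at hi hmin
  have hne0 : ∀ {j}, a j ≠ 0 → 0 < a j := fun {j} h => lt_of_le_of_ne (ha.1 j) h.symm
  by_cases hall : ∀ j, a j ≠ 0 → a j = a i
  · exact Or.inl ⟨a i, hi, hall⟩
  push Not at hall
  obtain ⟨j, hj0, hji⟩ := hall
  have hj := hne0 hj0
  have hlt : a i < a j := lt_of_le_of_ne (hmin j hj) hji.symm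
  refine Or.inr ⟨i, a j, hi, hlt, ⟨j, rfl⟩, fun l hl hl0 => ?_, heq hj hi hji⟩
  have hl' := hne0 hl0
  have e1 := heq hi hj hji.symm
  by_cases hli : a l = a i
  · have h2 := hle hl hl' hi
    rw [hli] at h2
    have := coeff_pairTerm_lt hG hi hi hlt (K := K) (hC.trans_le h2)
    linarith
  · have e2 := heq hi hl' (Ne.symm hli)
    by_contra h3
    rcases lt_or_gt_of_ne h3 with h | h
    · have := coeff_pairTerm_lt hG hi hl' h (K := K) (by rw [e2]; exact hC)
      linarith
    · have := coeff_pairTerm_lt hG hi hj h (K := K) (by rw [e1]; exact hC)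
      linarith

/-- Coefficientwise derivative of a family of power series. -/
def HasCoeffDerivAt (F : ℝ → PowerSeries ℝ) (F' : PowerSeries ℝ) (x : ℝ) : Prop :=
  ∀ j, HasDerivAt (fun y => coeff j (F y)) (coeff j F') x

lemma HasCoeffDerivAt.mul {F G : ℝ → PowerSeries ℝ} {F' G' : PowerSeries ℝ} {x : ℝ}
    (hF : HasCoeffDerivAt F F' x) (hG : HasCoeffDerivAt G G' x) :
    HasCoeffDerivAt (fun y => F y * G y) (F' * G x + F x * G') x := fun j => by
  simp only [coeff_mul, map_add, ← Finset.sum_add_distrib]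
  exact HasDerivAt.fun_sum fun p _ => (hF _).mul (hG _)

lemma HasCoeffDerivAt.sub {F G : ℝ → PowerSeries ℝ} {F' G' : PowerSeries ℝ} {x : ℝ}
    (hF : HasCoeffDerivAt F F' x) (hG : HasCoeffDerivAt G G' x) :
    HasCoeffDerivAt (fun y => F y - G y) (F' - G') x := fun j => by
  simp only [map_sub]
  exact (hF _).sub (hG _)

lemma hasCoeffDerivAt_const (F : PowerSeries ℝ) (x : ℝ) :
    HasCoeffDerivAt (fun _ => F) 0 x := fun j => by
  simpa using hasDerivAt_const x (coeff j F)

lemma hasCoeffDerivAt_C {f : ℝ → ℝ} {f' x : ℝ} (hf : HasDerivAt f f' x) :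
    HasCoeffDerivAt (fun y => C (f y)) (C f') x := fun j => by
  simp only [coeff_C]
  split_ifs
  exacts [hf, hasDerivAt_const _ _]

lemma coeff_geomSeries_mul_self (a : ℝ) (j : ℕ) :
    coeff j (geomSeries a * geomSeries a) = (j + 1) * a ^ j := by
  rw [coeff_mul, Finset.sum_congr rfl (g := fun _ => a ^ j)]
  · simp
  · intro p hp
    rw [coeff_geomSeries, coeff_geomSeries, ← pow_add, Finset.HasAntidiagonal.mem_antidiagonal.mp hp]

lemma hasCoeffDerivAt_geomSeries {f : ℝ → ℝ} {f' x : ℝ} (hf : HasDerivAt f f' x) :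
    HasCoeffDerivAt (fun y => geomSeries (f y))
      (C f' * (X * (geomSeries (f x) * geomSeries (f x)))) x := fun j => by
  simp only [coeff_geomSeries, coeff_C_mul]
  cases j with
  | zero => simpa using hasDerivAt_const x (1 : ℝ)
  | succ j =>
    rw [coeff_succ_X_mul, coeff_geomSeries_mul_self]
    refine (hf.fun_pow (j + 1)).congr_deriv ?_
    simp only [Nat.add_sub_cancel, Nat.cast_add, Nat.cast_one]
    ring

lemma hasCoeffDerivAt_geomSeries_pow {f : ℝ → ℝ} {f' x : ℝ} (hf : HasDerivAt f f' x) (n : ℕ) :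
    HasCoeffDerivAt (fun y => geomSeries (f y) ^ n)
      ((n : PowerSeries ℝ) * C f' * X * geomSeries (f x) * geomSeries (f x) ^ n) x := by
  induction n with
  | zero => simpa using hasCoeffDerivAt_const 1 x
  | succ n ih =>
    have := ih.mul (hasCoeffDerivAt_geomSeries hf)
    simp only [pow_succ]
    convert this using 1
    push_cast
    ring

lemma derivative_geomSeries (a : ℝ) :
    d⁄dX ℝ (geomSeries a) = C a * geomSeries a * geomSeries a := by
  ext j
  rw [mul_assoc, coeff_C_mul, coeff_geomSeries_mul_self, coeff_derivative, coeff_geomSeries]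
  ring

lemma derivative_geomSeries_pow (a : ℝ) (n : ℕ) :
    d⁄dX ℝ (geomSeries a ^ n) = n * C a * geomSeries a * geomSeries a ^ n := by
  induction n with
  | zero => simp
  | succ n ih =>
    rw [pow_succ, Derivation.leibniz, ih, derivative_geomSeries, smul_eq_mul, smul_eq_mul]
    push_cast
    ring

/-- Euler's identity for the complete homogeneous polynomials of `p` copies of `s` and `q` copies
of `t`. -/
lemma euler_two_values (s t : ℝ) (p q j : ℕ) :
    ((j : ℝ) + 1) * coeff (j + 1) (geomSeries s ^ p * geomSeries t ^ q)
      = p * s * coeff j (geomSeries s * (geomSeries s ^ p * geomSeries t ^ q))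
        + q * t * coeff j (geomSeries t * (geomSeries s ^ p * geomSeries t ^ q)) := by
  have h := coeff_derivative (R := ℝ) (geomSeries s ^ p * geomSeries t ^ q) j
  rw [Derivation.leibniz, derivative_geomSeries_pow, derivative_geomSeries_pow, smul_eq_mul,
    smul_eq_mul] at h
  have e : geomSeries s ^ p * (q * C t * geomSeries t * geomSeries t ^ q)
        + geomSeries t ^ q * (p * C s * geomSeries s * geomSeries s ^ p)
      = C (p * s) * (geomSeries s * (geomSeries s ^ p * geomSeries t ^ q))
        + C (q * t) * (geomSeries t * (geomSeries s ^ p * geomSeries t ^ q)) := by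
    simp only [map_mul, map_natCast]
    ring
  rw [e, map_add, coeff_C_mul, coeff_C_mul] at h
  linarith

lemma second_variation_neg_normalized {m κ : ℕ} (hm : 1 ≤ m) {x B S T β : ℝ} (hx : 0 < x)
    (hx1 : x < 1) (hB : 0 < B) (hS : 0 < S) (hT : 0 < T) (hβ : β ≤ T)
    (h1 : (m + 1) * S + 2 * x * T = κ * B)
    (h2 : (κ + 1) * ((1 + x) * B) = (m + 1 + 2 * x) * B + (m + 1) * S + 2 * x ^ 2 * T)
    (h3 : (m + 1) * S + 2 * T = (κ + m + 2) * β) :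
    m * (1 - x) * B + (m + 1) * x ^ 2 * S - 2 * m * T < 0 := by
  have hm' : (1 : ℝ) ≤ m := by exact_mod_cast hm
  have hy : 0 < 1 - x := by linarith
  have eS : (m + 1) * (1 - x) * S = (κ - m - x) * B := by
    linear_combination -h2 - x * h1
  have eT : 2 * x * (1 - x) * T = (m - (κ - 1) * x) * B := by
    linear_combination (1 - x) * h1 - eS
  have p1 : 0 < κ - m - x := by
    have : 0 < (κ - m - x) * B := by rw [← eS]; positivity
    exact pos_of_mul_pos_left this hB.le
  have p2 : 0 < m - (κ - 1) * x := by
    have : 0 < (m - (κ - 1) * x) * B := by rw [← eT]; positivity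
    exact pos_of_mul_pos_left this hB.le
  have hκ : m + 1 ≤ κ := by
    have : (m : ℝ) < κ := by linarith
    exact_mod_cast this
  have main : 0 < m - κ * x + x ^ 2 := by
    rcases hκ.eq_or_lt with h | h
    · have : (κ : ℝ) = m + 1 := by rw [← h]; push_cast; ring
      rw [this]
      nlinarith
    · have hκ2 : (m : ℝ) + 2 ≤ κ := by exact_mod_cast h
      have e : (κ + m + 2) * β * x * (1 - x) = (m + x) * (1 - x) * B := by
        linear_combination (-x * (1 - x)) * h3 + x * eS + eT
      have e1 : 2 * x * (1 - x) * β ≤ (m - (κ - 1) * x) * B := by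
        rw [← eT]; gcongr
      have e2 : 2 * ((m + x) * (1 - x)) * B ≤ (κ + m + 2) * (m - (κ - 1) * x) * B := by
        have := mul_le_mul_of_nonneg_left e1 (by positivity : (0 : ℝ) ≤ κ + m + 2)
        linarith
      have e3 := le_of_mul_le_mul_right e2 hB
      have e4 : x * (κ + m) < 2 * m := by nlinarith
      have e5 : (1 - x) * (x * (κ + m + 2)) < (1 - x) * (2 * (m + x)) :=
        mul_lt_mul_of_pos_left (by linarith) hy
      have e6 : 0 < (κ + m + 2) * (m - κ * x + x ^ 2) := by linarith
      exact pos_of_mul_pos_right e6 (by positivity)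
  have e : x * (1 - x) * (m * (1 - x) * B + (m + 1) * x ^ 2 * S - 2 * m * T)
      = -((m + x ^ 2) * (m - κ * x + x ^ 2) * B) := by
    linear_combination x ^ 3 * eS - m * eT
  have e' : x * (1 - x) * (m * (1 - x) * B + (m + 1) * x ^ 2 * S - 2 * m * T) < 0 := by
    rw [e, neg_lt_zero]; positivity
  exact (pos_iff_neg_of_mul_neg e').mp (by positivity)

lemma second_variation_neg {m κ : ℕ} (hm : 1 ≤ m) {s t B S T β : ℝ} (ht : 0 < t)
    (hts : t < s) (hB : 0 < B) (hS : 0 < S) (hT : 0 < T) (hβ : β ≤ T)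
    (h1 : (m + 1) * s * S + 2 * t * T = κ * B)
    (h2 : (κ + 1) * ((s + t) * B)
      = ((m + 1) * s + 2 * t) * B + (m + 1) * s ^ 2 * S + 2 * t ^ 2 * T)
    (h3 : (m + 1) * S + 2 * T = (κ + m + 2) * β) :
    m * (s - t) * B + (m + 1) * t ^ 2 * S - 2 * m * s ^ 2 * T < 0 := by
  have hs : 0 < s := ht.trans hts
  obtain ⟨x, rfl⟩ : ∃ x, t = x * s := ⟨t / s, by field_simp⟩
  obtain ⟨D, rfl⟩ : ∃ D, B = D * s := ⟨B / s, by field_simp⟩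
  have hx : 0 < x := pos_of_mul_pos_left ht hs.le
  have hx1 : x < 1 := by nlinarith
  have hD : 0 < D := pos_of_mul_pos_left hB hs.le
  have := second_variation_neg_normalized hm hx hx1 hD hS hT hβ
    (mul_right_cancel₀ hs.ne' (by linear_combination h1))
    (mul_right_cancel₀ (pow_pos hs 2).ne' (by linear_combination h2)) h3
  nlinarith [mul_neg_of_pos_of_neg (pow_pos hs 2) this]

lemma coeffNonneg_geomSeries_pow {a : ℝ} (ha : 0 ≤ a) (n : ℕ) : CoeffNonneg (geomSeries a ^ n) := by
  simpa using coeffNonneg_prod (Finset.range n) (fun _ => geomSeries a)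
    fun _ _ => coeffNonneg_geomSeries ha

lemma coeff_geomSeries_mul_pos {a : ℝ} (ha : 0 < a) {F : PowerSeries ℝ} (hF : CoeffNonneg F)
    (h0 : coeff 0 F = 1) (j : ℕ) : 0 < coeff j (geomSeries a * F) := by
  have := (coeffNonneg_geomSeries ha.le).coeff_mul_constantCoeff_le hF j
  rw [h0, coeff_geomSeries, mul_one] at this
  exact (pow_pos ha j).trans_le this

/-- The second variation at a critical point with `m` entries `s` and a single entry `t < s`, in
the direction that keeps the `m` entries equal, is negative. -/
lemma coeff_second_variation_neg {m : ℕ} (hm : 1 ≤ m) {s t : ℝ} (ht : 0 < t) (hts : t < s) (κ : ℕ)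
    (hE : coeff (κ + 1) (geomSeries s ^ (m + 1) * geomSeries t ^ 2)
      = (s + t) * coeff κ (geomSeries s ^ (m + 1) * geomSeries t ^ 2)) :
    coeff (κ + 1) (C (m * (s - t)) * X * (geomSeries s ^ (m + 1) * geomSeries t ^ 2)
      + C ((m + 1) * t ^ 2) * X ^ 2 * (geomSeries s * (geomSeries s ^ (m + 1) * geomSeries t ^ 2))
      - C (2 * m * s ^ 2) * X ^ 2 * (geomSeries t * (geomSeries s ^ (m + 1) * geomSeries t ^ 2)))
      < 0 := by
  have hs : 0 < s := ht.trans hts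
  set b := geomSeries s ^ (m + 1) * geomSeries t ^ 2 with hb
  have hbN : CoeffNonneg b :=
    (coeffNonneg_geomSeries_pow hs.le _).mul (coeffNonneg_geomSeries_pow ht.le _)
  have hb0 : coeff 0 b = 1 := by simp [hb, geomSeries]
  cases κ with
  | zero =>
    exfalso
    have h := euler_two_values s t (m + 1) 2 0
    rw [← hb] at h
    have c0 : ∀ a, coeff 0 (geomSeries a * b) = 1 := fun a => by
      rw [coeff_zero_eq_constantCoeff_apply, map_mul, ← coeff_zero_eq_constantCoeff_apply,
        ← coeff_zero_eq_constantCoeff_apply, hb0, coeff_geomSeries]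
      simp
    rw [c0, c0, hE, hb0] at h
    push_cast at h
    have : (0 : ℝ) ≤ m := Nat.cast_nonneg m
    nlinarith
  | succ l =>
    have hS := coeff_geomSeries_mul_pos hs hbN hb0 l
    have hT := coeff_geomSeries_mul_pos ht hbN hb0 l
    have hB : 0 < coeff (l + 1) b := by
      have e : b = geomSeries t * (geomSeries s ^ (m + 1) * geomSeries t) := by rw [hb]; ring
      rw [e]
      exact coeff_geomSeries_mul_pos ht
        ((coeffNonneg_geomSeries_pow hs.le _).mul (coeffNonneg_geomSeries ht.le))
        (by simp [geomSeries]) _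
    have h1 := euler_two_values s t (m + 1) 2 l
    have h2 := euler_two_values s t (m + 1) 2 (l + 1)
    rw [← hb] at h1 h2
    rw [hE, coeff_succ_geomSeries_mul, coeff_succ_geomSeries_mul] at h2
    have hβ : coeff l b ≤ coeff l (geomSeries t * b) := by
      cases l with
      | zero =>
        have := (coeffNonneg_geomSeries ht.le).coeff_mul_constantCoeff_le hbN 0
        rw [hb0] at this ⊢
        simpa using this
      | succ l =>
        rw [coeff_succ_geomSeries_mul]
        have := mul_pos ht (coeff_geomSeries_mul_pos ht hbN hb0 l)
        linarith
    have h3 : ((m : ℝ) + 1) * coeff l (geomSeries s * b) + 2 * coeff l (geomSeries t * b)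
        = (((l + 1 : ℕ) : ℝ) + m + 2) * coeff l b := by
      cases l with
      | zero =>
        have c0 : ∀ a, coeff 0 (geomSeries a * b) = 1 := fun a => by
          rw [coeff_zero_eq_constantCoeff_apply, map_mul, ← coeff_zero_eq_constantCoeff_apply,
            ← coeff_zero_eq_constantCoeff_apply, hb0, coeff_geomSeries]
          simp
        rw [c0, c0, hb0]; push_cast; ring
      | succ l =>
        have h := euler_two_values s t (m + 1) 2 l
        rw [← hb] at h
        rw [coeff_succ_geomSeries_mul, coeff_succ_geomSeries_mul]
        push_cast at h ⊢
        linear_combination -h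
    have main := second_variation_neg (κ := l + 1) hm ht hts hB hS hT hβ
      (by push_cast at h1 ⊢; linear_combination -h1)
      (by push_cast at h2 ⊢; linear_combination h2) h3
    have hX2 : ∀ F : PowerSeries ℝ, coeff (l + 1 + 1) (X ^ 2 * F) = coeff l F :=
      fun F => coeff_X_pow_mul F 2 l
    rw [map_sub, map_add, mul_assoc, mul_assoc, mul_assoc, coeff_C_mul, coeff_C_mul, coeff_C_mul,
      coeff_succ_X_mul, hX2, hX2]
    exact main

/-- Copies of `s` together with a single smaller `t` never minimize. -/
lemma exists_lt_of_two_values {m : ℕ} (hm : 1 ≤ m) {s t : ℝ} (ht : 0 < t) (hts : t < s) {K : ℕ}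
    (hE : coeff K (pairTerm (geomSeries s ^ m * geomSeries t) s t)
      = coeff K (geomSeries s ^ m * geomSeries t)) :
    ∃ s' t', 0 ≤ s' ∧ 0 ≤ t' ∧ m * s' ^ 2 + t' ^ 2 = m * s ^ 2 + t ^ 2 ∧
      coeff (K + 1) (geomSeries s' ^ m * geomSeries t')
        < coeff (K + 1) (geomSeries s ^ m * geomSeries t) := by
  by_contra! hmin
  have hs : 0 < s := ht.trans hts
  have hm0 : (0 : ℝ) < m := by exact_mod_cast hm
  set α := √(m : ℝ) with hα
  have hα0 : 0 < α := Real.sqrt_pos.mpr hm0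
  have hα2 : α ^ 2 = m := Real.sq_sqrt hm0.le
  let σ : ℝ → ℝ := fun θ => s * Real.cos θ - t / α * Real.sin θ
  let τ : ℝ → ℝ := fun θ => t * Real.cos θ + α * s * Real.sin θ
  have hσ : ∀ θ, HasDerivAt σ (-(τ θ) / α) θ := fun θ => by
    have := ((Real.hasDerivAt_cos θ).const_mul s).sub ((Real.hasDerivAt_sin θ).const_mul (t / α))
    refine this.congr_deriv ?_
    simp only [τ]; field_simp; ring
  have hτ : ∀ θ, HasDerivAt τ (α * σ θ) θ := fun θ => by
    have := ((Real.hasDerivAt_cos θ).const_mul t).add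
      ((Real.hasDerivAt_sin θ).const_mul (α * s))
    refine this.congr_deriv ?_
    simp only [σ]; field_simp; ring
  have hσ0 : σ 0 = s := by simp [σ]
  have hτ0 : τ 0 = t := by simp [τ]
  let p : ℝ → ℝ := fun θ => coeff (K + 1) (geomSeries (σ θ) ^ m * geomSeries (τ θ))
  let b : ℝ → PowerSeries ℝ := fun θ => geomSeries (σ θ) ^ (m + 1) * geomSeries (τ θ) ^ 2
  let E : ℝ → PowerSeries ℝ := fun θ => (1 - C (σ θ + τ θ) * X) * b θ
  have hp : ∀ θ, HasDerivAt p (α * (σ θ - τ θ) * coeff K (E θ)) θ := fun θ => by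
    have h := ((hasCoeffDerivAt_geomSeries_pow (hσ θ) m).mul
      (hasCoeffDerivAt_geomSeries (hτ θ))) (K + 1)
    convert h using 1
    have g1 := one_sub_mul_geomSeries (σ θ)
    have g2 := one_sub_mul_geomSeries (τ θ)
    have hmC : (m : PowerSeries ℝ) * C (-(τ θ) / α) = - C (α * τ θ) := by
      rw [← map_natCast (C (R := ℝ)), ← map_mul, ← map_neg, ← hα2]
      congr 1; field_simp
    rw [hmC, ← coeff_C_mul, ← coeff_succ_X_mul]
    congr 1
    simp only [E, b, map_mul, map_sub, map_add]
    linear_combination (X * C α * geomSeries (σ θ) ^ m * geomSeries (τ θ) * geomSeries (τ θ)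
      * C (σ θ)) * g1 - (X * C α * geomSeries (σ θ) ^ m * geomSeries (τ θ) * geomSeries (σ θ)
      * C (τ θ)) * g2
  have hdp : deriv p = fun θ => α * (σ θ - τ θ) * coeff K (E θ) := funext fun θ => (hp θ).deriv
  have hE0 : coeff K (E 0) = 0 := by
    have e : E 0 = geomSeries s ^ m * geomSeries t
        - pairTerm (geomSeries s ^ m * geomSeries t) s t := by
      rw [← one_sub_add_mul_geomSeries]
      simp only [E, b, hσ0, hτ0]
      ring
    rw [e, map_sub, hE, sub_self]
  have hEd := (((hasCoeffDerivAt_const 1 0).sub ((hasCoeffDerivAt_C ((hσ 0).add (hτ 0))).mul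
    (hasCoeffDerivAt_const X 0))).mul ((hasCoeffDerivAt_geomSeries_pow (hσ 0) (m + 1)).mul
    (hasCoeffDerivAt_geomSeries_pow (hτ 0) 2))) K
  rw [hσ0, hτ0] at hEd
  simp only [Pi.add_apply, hσ0, hτ0] at hEd
  set G := geomSeries s ^ (m + 1) * geomSeries t ^ 2 with hG
  have hK : K ≠ 0 := by
    rintro rfl
    have e : E 0 = (1 - C (s + t) * X) * G := by simp only [E, b, hσ0, hτ0, hG]
    rw [e] at hE0
    simp [hG, geomSeries] at hE0
  obtain ⟨κ, rfl⟩ := Nat.exists_eq_succ_of_ne_zero hK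
  have hcrit : coeff (κ + 1) G = (s + t) * coeff κ G := by
    have e : E 0 = G - C (s + t) * (X * G) := by
      simp only [E, b, hσ0, hτ0, hG]; ring
    rw [e, map_sub, coeff_C_mul, coeff_succ_X_mul] at hE0
    linarith
  have hneg := coeff_second_variation_neg hm ht hts κ hcrit
  have hddp : deriv (deriv p) 0 < 0 := by
    have h1 : HasDerivAt (fun θ => α * (σ θ - τ θ)) (α * (-t / α - α * s)) 0 := by
      have := ((hσ 0).fun_sub (hτ 0)).const_mul α
      rwa [hσ0, hτ0] at this
    have h2 := (h1.fun_mul hEd).deriv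
    rw [hdp]
    refine lt_of_eq_of_lt h2 ?_
    have h3 : coeff (κ + 1) ((1 - C (σ 0 + τ 0) * X) *
        (geomSeries (σ 0) ^ (m + 1) * geomSeries (τ 0) ^ 2)) = 0 := hE0
    rw [h3, mul_zero, zero_add, hσ0, hτ0, mul_comm α, mul_assoc, ← coeff_C_mul]
    refine mul_neg_of_pos_of_neg (by linarith) ?_
    refine lt_of_eq_of_lt ?_ hneg
    congr 1
    have g1 := one_sub_mul_geomSeries s
    have g2 := one_sub_mul_geomSeries t
    have c1 : C α * C (-t / α) = -C t := by
      rw [← map_mul, ← map_neg]; congr 1; field_simp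
    have c2 : C α * C (α * s) = (m : PowerSeries ℝ) * C s := by
      rw [← map_natCast (C (R := ℝ)), ← map_mul, ← map_mul, ← hα2]; congr 1; ring
    simp only [map_add, map_sub, map_mul, map_pow, map_natCast, map_one, map_ofNat,
      Nat.cast_add, Nat.cast_one, Nat.cast_ofNat] at c2 ⊢
    linear_combination (-X * G + (1 - (C s + C t) * X) * (m + 1) * X * geomSeries s * G) * c1
      + (-X * G + (1 - (C s + C t) * X) * 2 * X * geomSeries t * G) * c2
      - ((m + 1) * C t * X * G) * g1 + (2 * m * C s * X * G) * g2
  have hlm : IsLocalMax p 0 := isLocalMax_of_deriv_deriv_neg hddp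
    (by rw [(hp 0).deriv, hE0, mul_zero]) (hp 0).continuousAt
  have hlmin : IsLocalMin p 0 := by
    have hs' : ∀ᶠ θ in 𝓝 (0 : ℝ), 0 < σ θ :=
      (hσ 0).continuousAt.eventually_const_lt (by rwa [hσ0])
    have ht' : ∀ᶠ θ in 𝓝 (0 : ℝ), 0 < τ θ :=
      (hτ 0).continuousAt.eventually_const_lt (by rwa [hτ0])
    filter_upwards [hs', ht'] with θ h1 h2
    simp only [p, hσ0, hτ0]
    refine hmin _ _ h1.le h2.le ?_
    have hc := Real.sin_sq_add_cos_sq θ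
    have : (t / α) * α = t := by field_simp
    simp only [σ, τ]
    rw [← hα2]
    have e : α ^ 2 * (s * Real.cos θ - t / α * Real.sin θ) ^ 2
        = (α * s * Real.cos θ - t * Real.sin θ) ^ 2 := by
      rw [← mul_pow]; congr 1; linear_combination -Real.sin θ * this
    rw [e]
    linear_combination (α ^ 2 * s ^ 2 + t ^ 2) * hc
  have hconst : p =ᶠ[𝓝 0] fun _ => p 0 := by
    filter_upwards [hlm, hlmin] with θ h1 h2
    exact le_antisymm h1 h2
  have : deriv (deriv p) 0 = 0 := by
    have h1 : deriv p =ᶠ[𝓝 0] deriv fun _ => p 0 := hconst.deriv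
    rw [h1.deriv_eq]
    simp
  linarith

/-- The moments of the standard exponential distribution. -/
lemma integrable_pow_expMeasure_and_integral (k : ℕ) :
    Integrable (fun x : ℝ => x ^ k) (expMeasure 1) ∧
      ∫ x, x ^ k ∂(expMeasure 1) = (k.factorial : ℝ) := by
  have hmeas : Measurable (gammaPDF 1 1) :=
    (measurable_gammaPDFReal 1 1).ennreal_ofReal
  have hfin : ∀ᵐ x : ℝ, gammaPDF 1 1 x < ⊤ := Eventually.of_forall fun x => ENNReal.ofReal_lt_top
  have hfun : (fun x : ℝ => (gammaPDF 1 1 x).toReal • x ^ k) =ᵐ[volume]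
      Set.indicator (Set.Ioi 0) fun x => Real.exp (-x) * x ^ (((k : ℝ) + 1) - 1) := by
    have h0 : ∀ᵐ x : ℝ, x ≠ 0 := by simp [ae_iff]
    filter_upwards [h0] with x hx0
    rcases lt_or_gt_of_ne hx0 with hx | hx
    · rw [gammaPDF_of_neg hx, Set.indicator_of_notMem (by simp [hx.le])]
      simp
    · rw [gammaPDF_of_nonneg hx.le, Set.indicator_of_mem (by simpa using hx),
        ENNReal.toReal_ofReal (by positivity)]
      simp
  have hint : IntegrableOn (fun x : ℝ => Real.exp (-x) * x ^ (((k : ℝ) + 1) - 1)) (Set.Ioi 0) :=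
    Real.GammaIntegral_convergent (by positivity)
  constructor
  · rw [expMeasure, gammaMeasure, integrable_withDensity_iff_integrable_smul' hmeas hfin,
      integrable_congr hfun, integrable_indicator_iff measurableSet_Ioi]
    exact hint
  · rw [expMeasure, gammaMeasure, integral_withDensity_eq_integral_toReal_smul hmeas hfin,
      integral_congr_ae hfun, integral_indicator measurableSet_Ioi,
      ← Real.Gamma_eq_integral (by positivity), Real.Gamma_nat_eq_factorial]

section
variable {Ω : Type*} [MeasurableSpace Ω] {μ : Measure Ω} {n : ℕ}
  {X : Fin n → Ω → ℝ}

lemma IsIIDStdExp.moment (hX : IsIIDStdExp X μ) (i : Fin n) (c : ℝ) (k : ℕ) :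
    Integrable (fun ω => (c * X i ω) ^ k) μ ∧ ∫ ω, (c * X i ω) ^ k ∂μ = k.factorial * c ^ k := by
  have h := integrable_pow_expMeasure_and_integral k
  have hm : AEMeasurable (X i) μ := (hX.law i).aemeasurable
  simp only [mul_pow]
  constructor
  · refine Integrable.const_mul ?_ _
    have h1 := h.1
    rw [← (hX.law i).map_eq] at h1
    exact h1.comp_aemeasurable hm
  · rw [integral_const_mul, mul_comm]
    congr 1
    rw [← h.2, ← (hX.law i).map_eq, integral_map hm (by fun_prop)]

lemma IsIIDStdExp.moment_sum [IsProbabilityMeasure μ] (hX : IsIIDStdExp X μ) (a : Fin n → ℝ) (s : Finset (Fin n)) (k : ℕ) :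
    Integrable (fun ω => (∑ i ∈ s, a i * X i ω) ^ k) μ ∧
      ∫ ω, (∑ i ∈ s, a i * X i ω) ^ k ∂μ
        = k.factorial * coeff k (∏ i ∈ s, geomSeries (a i)) := by
  induction s using Finset.induction_on generalizing k with
  | empty =>
    rcases Nat.eq_zero_or_pos k with rfl | hk
    · simp
    · simp [coeff_one, hk.ne']
  | insert i s hi ih =>
    have hm : ∀ i, AEMeasurable (X i) μ := fun i => (hX.law i).aemeasurable
    have hind : IndepFun (fun ω => ∑ j ∈ s, a j * X j ω) (fun ω => a i * X i ω) μ := by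
      have h1 : iIndepFun (fun j ω => a j * X j ω) μ :=
        hX.indep.comp (fun j x => a j * x) fun j => by fun_prop
      have := h1.indepFun_finsetSum_of_notMem₀ (fun j => (hm j).const_mul _) hi
      convert this using 1
      ext ω
      simp
    have hsm : AEMeasurable (fun ω => ∑ j ∈ s, a j * X j ω) μ := by fun_prop
    have hpow : ∀ p q : ℕ, IndepFun (fun ω => (∑ j ∈ s, a j * X j ω) ^ p)
        (fun ω => (a i * X i ω) ^ q) μ := fun p q =>
      hind.comp (φ := fun x => x ^ p) (ψ := fun x => x ^ q) (by fun_prop) (by fun_prop)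
    have hexp : ∀ ω, (∑ j ∈ insert i s, a j * X j ω) ^ k
        = ∑ p ∈ Finset.HasAntidiagonal.antidiagonal k, (k.choose p.1 : ℝ) *
          ((∑ j ∈ s, a j * X j ω) ^ p.2 * (a i * X i ω) ^ p.1) := fun ω => by
      rw [Finset.sum_insert hi, (Commute.all _ _).add_pow']
      refine Finset.sum_congr rfl fun p _ => ?_
      rw [nsmul_eq_mul, mul_comm ((a i * X i ω) ^ p.1)]
    simp only [hexp]
    have hI : ∀ p : ℕ × ℕ, Integrable (fun ω => (k.choose p.1 : ℝ) *
          ((∑ j ∈ s, a j * X j ω) ^ p.2 * (a i * X i ω) ^ p.1)) μ := fun p =>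
      ((hpow p.2 p.1).integrable_mul (ih p.2).1 (hX.moment i (a i) p.1).1).const_mul _
    refine ⟨integrable_finsetSum _ fun p _ => hI p, ?_⟩
    rw [integral_finsetSum _ fun p _ => hI p, Finset.prod_insert hi, coeff_mul, Finset.mul_sum]
    refine Finset.sum_congr rfl fun p hp => ?_
    rw [integral_const_mul, (hpow p.2 p.1).integral_fun_mul_eq_mul_integral
      (ih p.2).1.aestronglyMeasurable (hX.moment i (a i) p.1).1.aestronglyMeasurable,
      (ih p.2).2, (hX.moment i (a i) p.1).2, coeff_geomSeries]
    have hk : p.1 + p.2 = k := Finset.HasAntidiagonal.mem_antidiagonal.mp hp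
    have := Nat.add_choose_mul_factorial_mul_factorial p.2 p.1
    rw [add_comm, hk] at this
    have h' : (k.choose p.1 : ℝ) * p.2.factorial * p.1.factorial = k.factorial := by
      exact_mod_cast this
    rw [← h']
    ring

lemma IsIIDStdExp.linMoment_eq [IsProbabilityMeasure μ] (hX : IsIIDStdExp X μ) (a : Fin n → ℝ) (k : ℕ) :
    linMoment X μ k a = k.factorial * completeHomog a k :=
  (hX.moment_sum a Finset.univ k).2
end

lemma isIIDStdExp_pi (m : ℕ) : IsIIDStdExp (fun (i : Fin m) (x : Fin m → ℝ) => x i)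
    (Measure.pi fun _ : Fin m => expMeasure 1) := by
  have := isProbabilityMeasure_expMeasure one_pos
  refine ⟨iIndepFun_pi (X := fun _ x => x) fun i => aemeasurable_id, fun i => ?_⟩
  exact ⟨(measurable_pi_apply i).aemeasurable, (measurePreserving_eval (fun _ : Fin m => expMeasure 1) i).map_eq⟩

lemma rho_eq (m k : ℕ) : rho m k = k.factorial * coeff k (geomSeries (1 / √(m : ℝ)) ^ m) := by
  have := isProbabilityMeasure_expMeasure one_pos
  have h := (isIIDStdExp_pi m).linMoment_eq (fun _ => 1 / √(m : ℝ)) k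
  rw [completeHomog, Finset.prod_const, Finset.card_univ, Fintype.card_fin] at h
  rw [← h, rho, linMoment]
  simp only [Finset.sum_div, one_div_mul_eq_div]

lemma isCompact_nonnegSphere (n : ℕ) : IsCompact (nonnegSphere n) := by
  refine (isCompact_Icc (a := (0 : Fin n → ℝ)) (b := 1)).of_isClosed_subset ?_ ?_
  · have e : nonnegSphere n = (⋂ i, {a : Fin n → ℝ | 0 ≤ a i}) ∩ {a | ∑ i, a i ^ 2 = 1} := by
      ext a; simp [nonnegSphere]
    rw [e]
    exact (isClosed_iInter fun i => isClosed_le continuous_const (continuous_apply i)).inter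
      (isClosed_eq (by fun_prop) continuous_const)
  · intro a ha
    refine ⟨fun i => ha.1 i, fun i => ?_⟩
    have h := Finset.single_le_sum (f := fun i => a i ^ 2) (fun i _ => sq_nonneg (a i))
      (Finset.mem_univ i)
    simp only [ha.2] at h
    exact (sq_le_one_iff₀ (ha.1 i)).mp h

lemma const_mem_nonnegSphere {n : ℕ} (hn : 1 ≤ n) :
    (fun _ => 1 / √(n : ℝ)) ∈ nonnegSphere n := by
  have hn0 : (0 : ℝ) < n := by exact_mod_cast hn
  refine ⟨fun i => by positivity, ?_⟩
  simp only [Finset.sum_const, Finset.card_univ, Fintype.card_fin, nsmul_eq_mul, div_pow,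
    Real.sq_sqrt hn0.le]
  field_simp

@[to_additive]
lemma prod_ite_eq_ite_mem {M : Type*} [CommMonoid M] {n : ℕ} (φ : ℝ → M) (h0 : φ 0 = 1)
    {S : Finset (Fin n)} {i : Fin n} (hi : i ∉ S) (x y : ℝ) :
    ∏ l, φ (if l = i then y else if l ∈ S then x else 0) = φ x ^ S.card * φ y := by
  rw [← Finset.mul_prod_erase _ _ (Finset.mem_univ i), if_pos rfl, mul_comm]
  congr 1
  have h1 : ∀ l ∈ Finset.univ.erase i, φ (if l = i then y else if l ∈ S then x else 0)
      = if l ∈ S then φ x else 1 := by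
    intro l hl
    rw [if_neg (Finset.ne_of_mem_erase hl)]
    split_ifs
    exacts [rfl, h0]
  rw [Finset.prod_congr rfl h1, Finset.prod_ite, Finset.prod_const, Finset.prod_const_one, mul_one]
  congr 2
  ext l
  simp only [Finset.mem_filter, Finset.mem_erase, Finset.mem_univ, and_true, ne_eq]
  exact ⟨fun h => h.2, fun h => ⟨fun e => hi (e ▸ h), h⟩⟩

/-- The minimum of `h_k` is attained at a vector with equal nonzero entries. -/
lemma exists_equal_le_completeHomog {n : ℕ} (hn : 1 ≤ n) (k : ℕ) {a : Fin n → ℝ}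
    (ha : a ∈ nonnegSphere n) :
    ∃ m ∈ Finset.Icc 1 n, coeff k (geomSeries (1 / √(m : ℝ)) ^ m) ≤ completeHomog a k := by
  rcases k with _ | K
  · refine ⟨1, by simp [hn], ?_⟩
    rw [completeHomog, coeff_zero_prod_geomSeries]
    simp [geomSeries]
  obtain ⟨c, hc, hmin⟩ := (isCompact_nonnegSphere n).exists_isMinOn ⟨a, ha⟩
    (continuous_completeHomog n (K + 1)).continuousOn
  have hmin' : ∀ b ∈ nonnegSphere n, completeHomog c (K + 1) ≤ completeHomog b (K + 1) :=
    fun b hb => hmin hb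
  suffices ∃ m ∈ Finset.Icc 1 n,
      coeff (K + 1) (geomSeries (1 / √(m : ℝ)) ^ m) = completeHomog c (K + 1) by
    obtain ⟨m, hm, he⟩ := this
    exact ⟨m, hm, he.le.trans (hmin' a ha)⟩
  rcases shape_of_min hc hmin' with ⟨r, hr, hall⟩ | ⟨i, s, hti, hts, ⟨j, hj⟩, hall, hcrit⟩
  · obtain ⟨p, hp⟩ := exists_pos_of_mem_nonnegSphere hc
    set S := Finset.univ.filter fun l => c l ≠ 0 with hS
    have hcr : ∀ l, c l = if l ∈ S then r else 0 := by
      intro l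
      by_cases h : c l = 0
      · simp [hS, h]
      · simp [hS, hall l h]
    have hcard : 1 ≤ S.card := Finset.card_pos.mpr ⟨p, by simp [hS, hp.ne']⟩
    have hsum : (S.card : ℝ) * r ^ 2 = 1 := by
      have e : ∀ l ∈ Finset.univ, c l ^ 2 = if l ∈ S then r ^ 2 else 0 := fun l _ => by
        rw [hcr l]; split_ifs <;> simp
      rw [← hc.2, Finset.sum_congr rfl e, Finset.sum_ite_mem, Finset.univ_inter, Finset.sum_const,
        nsmul_eq_mul]
    have hreq : r = 1 / √(S.card : ℝ) := by
      have h0 : (0 : ℝ) < S.card := by exact_mod_cast hcard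
      rw [eq_div_iff (Real.sqrt_pos.mpr h0).ne']
      have : (r * √(S.card : ℝ)) ^ 2 = 1 := by rw [mul_pow, Real.sq_sqrt h0.le]; linarith
      exact (pow_eq_one_iff_of_nonneg
        (mul_nonneg hr.le (Real.sqrt_nonneg _)) two_ne_zero).mp this
    refine ⟨S.card, Finset.mem_Icc.mpr ⟨hcard, (Finset.card_le_univ S).trans (by simp)⟩, ?_⟩
    have e : ∀ l ∈ Finset.univ, geomSeries (c l) = if l ∈ S then geomSeries r else 1 :=
      fun l _ => by rw [hcr l]; split_ifs <;> simp
    rw [← hreq, completeHomog, Finset.prod_congr rfl e, Finset.prod_ite_mem, Finset.univ_inter,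
      Finset.prod_const]
  · exfalso
    set S := Finset.univ.filter fun l => l ≠ i ∧ c l ≠ 0 with hS
    have hi : i ∉ S := by simp [hS]
    have hcr : c = fun l => if l = i then c i else if l ∈ S then s else 0 := by
      ext l
      by_cases hl : l = i
      · simp [hl]
      · by_cases h : c l = 0
        · simp [hS, hl, h]
        · simp [hS, hl, hall l hl h]
    have hji : j ≠ i := by rintro rfl; linarith
    have hcard : 1 ≤ S.card :=
      Finset.card_pos.mpr ⟨j, by simp only [hS, Finset.mem_filter, Finset.mem_univ, true_and]
                                 exact ⟨hji, by rw [hj]; linarith⟩⟩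
    have hprod : ∀ x y : ℝ, ∏ l, geomSeries (if l = i then y else if l ∈ S then x else 0)
        = geomSeries x ^ S.card * geomSeries y :=
      prod_ite_eq_ite_mem geomSeries geomSeries_zero hi
    have hsum : ∀ x y : ℝ, ∑ l, (if l = i then y else if l ∈ S then x else 0) ^ 2
        = S.card * x ^ 2 + y ^ 2 := fun x y => by
      rw [← nsmul_eq_mul]
      exact sum_ite_eq_ite_mem (fun z : ℝ => z ^ 2) (by simp) hi x y
    have hG : ∏ l, geomSeries (c l) = geomSeries s ^ S.card * geomSeries (c i) := by
      rw [← hprod]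
      exact Finset.prod_congr rfl fun l _ => congrArg geomSeries (congrFun hcr l)
    have hN : S.card * s ^ 2 + c i ^ 2 = 1 := by
      rw [← hsum, ← hc.2]
      exact Finset.sum_congr rfl fun l _ => by rw [← congrFun hcr l]
    rw [hG] at hcrit
    obtain ⟨s', t', hs', ht', hst, hlt⟩ := exists_lt_of_two_values hcard hti hts hcrit
    have hb : (fun l => if l = i then t' else if l ∈ S then s' else 0) ∈ nonnegSphere n := by
      refine ⟨fun l => ?_, by rw [hsum, hst, hN]⟩
      dsimp only
      split_ifs
      exacts [ht', hs', le_rfl]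
    have := hmin' _ hb
    rw [completeHomog, completeHomog, hprod, hG] at this
    linarith

lemma coeff_geomSeries_pow_succ (a : ℝ) (p i : ℕ) :
    coeff i (geomSeries a ^ (p + 1)) = (p + i).choose p * a ^ i := by
  induction p generalizing i with
  | zero => simp
  | succ p ih =>
    induction i with
    | zero => simp [geomSeries]
    | succ i ih' =>
      rw [pow_succ', coeff_succ_geomSeries_mul, ← pow_succ', ih, ih',
        show p + 1 + (i + 1) = (p + 1 + i) + 1 by ring, Nat.choose_succ_succ,
        show p + (i + 1) = p + 1 + i by ring]
      push_cast
      ring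

/-- `ratioPoly` is a multiple of the derivative of the objective along `(1, x, …, x)`. -/
lemma eval_ratioPoly (N K : ℕ) (x : ℝ) :
    (ratioPoly (N + 2) (K + 1)).eval x = (K + 1).factorial * (N + 1).factorial *
      (∑ i ∈ Finset.range (K + 1), ((N + 1 + i).choose (N + 1) : ℝ) * x ^ i
        - ∑ i ∈ Finset.range (K + 1), ((K : ℝ) + 1 - i) * (N + i).choose N * x ^ (i + 1)) := by
  have gam : ∀ (y : ℝ) (q : ℕ), y = q + 1 → Real.Gamma y = q.factorial := by
    rintro _ q rfl
    exact Real.Gamma_nat_eq_factorial q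
  have ch : ∀ p i : ℕ, ((p + i).choose p : ℝ) * p.factorial * i.factorial = (p + i).factorial :=
    fun p i => by
      rw [add_comm p i, mul_right_comm]
      exact_mod_cast Nat.add_choose_mul_factorial_mul_factorial i p
  have fs : ∀ p : ℕ, ((p + 1).factorial : ℝ) = (p + 1) * p.factorial := fun p => by
    rw [Nat.factorial_succ]; push_cast; ring
  rw [Finset.sum_range_succ', Finset.sum_range_succ (fun i : ℕ =>
    ((K : ℝ) + 1 - i) * (N + i).choose N * x ^ (i + 1))]
  simp only [ratioPoly, Polynomial.eval_sub, Polynomial.eval_add, Polynomial.eval_C,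
    Polynomial.eval_finsetSum, Polynomial.eval_mul, Polynomial.eval_pow, Polynomial.eval_X,
    Nat.add_sub_cancel]
  have hsum : ∀ j ∈ Finset.range K,
      (((K + 1).choose j : ℝ) * Real.Gamma ((j : ℝ) + (N + 2 : ℕ) - 1)
          * Real.Gamma (((K + 1 : ℕ) : ℝ) - j + 1) * (((N + 2 : ℕ) : ℝ) - 1)
          * ((j : ℝ) - (K + 1 : ℕ))
        + ((j : ℝ) + 2) * ((K + 1).choose (j + 2) : ℝ) * Real.Gamma ((j : ℝ) + (N + 2 : ℕ) + 1)
          * Real.Gamma (((K + 1 : ℕ) : ℝ) - j - 1)) * x ^ (j + 1)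
      = (K + 1).factorial * (N + 1).factorial *
        (((N + 1 + (j + 1)).choose (N + 1) : ℝ) * x ^ (j + 1)
          - ((K : ℝ) + 1 - j) * (N + j).choose N * x ^ (j + 1)) := by
    intro j hj
    obtain ⟨d, rfl⟩ : ∃ d, K = j + d + 1 := Nat.exists_eq_add_of_lt (Finset.mem_range.mp hj)
    rw [gam _ (N + j) (by push_cast; ring), gam _ (d + 2) (by push_cast; ring),
      gam _ (N + 1 + (j + 1)) (by push_cast; ring), gam _ d (by push_cast; ring)]
    have e1 := ch j (d + 2)
    have e2 := ch (j + 2) d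
    have e3 := ch N j
    have e4 := ch (N + 1) (j + 1)
    rw [show j + (d + 2) = j + d + 1 + 1 by ring] at e1
    rw [show j + 2 + d = j + d + 1 + 1 by ring] at e2
    have f1 := fs N
    have f2 := fs (j + 1)
    rw [show j + 1 + 1 = j + 2 by ring] at f2
    rw [← e3, ← e4]
    push_cast at f1 f2 ⊢
    have k1 : ((j + d + 1 + 1).choose (j + 2) : ℝ) * ((j + 2) * (j + 1).factorial) * d.factorial
        = (j + d + 1 + 1).factorial := by rw [← e2, f2]; ring
    have k2 : ((N + 1).factorial : ℝ) = (N + 1) * N.factorial := f1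
    linear_combination (x ^ (j + 1) * (N + 1 + (j + 1)).choose (N + 1) * (N + 1).factorial) * k1
      - (x ^ (j + 1) * (d + 2) * (N + j).choose N * (N + 1) * N.factorial) * e1
      + ((j + d + 1 + 1).factorial * x ^ (j + 1) * (d + 2) * (N + j).choose N) * k2
  rw [Finset.sum_congr rfl hsum, ← Finset.mul_sum, Finset.sum_sub_distrib,
    gam _ (N + 1) (by push_cast; ring), gam _ K (by push_cast; ring),
    gam _ (N + K) (by push_cast; ring)]
  have e := ch N K
  rw [← e]
  have f1 := fs N
  have f2 := fs K
  rw [f1, f2]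
  push_cast
  simp only [add_zero, Nat.choose_self, Nat.cast_one, pow_zero]
  ring

lemma isRoot_ratioPoly {n K : ℕ} (hn : 2 ≤ n) {s t : ℝ} (hs : 0 < s)
    (h : s * coeff K (geomSeries s * geomSeries t ^ n)
      = t * coeff K (geomSeries s * geomSeries s * geomSeries t ^ (n - 1))) :
    (ratioPoly n (K + 1)).IsRoot (t / s) := by
  obtain ⟨N, rfl⟩ := Nat.exists_eq_add_of_le' hn
  obtain ⟨x, rfl⟩ : ∃ x, t = x * s := ⟨t / s, by field_simp⟩
  rw [mul_div_cancel_right₀ _ hs.ne', Polynomial.IsRoot, eval_ratioPoly]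
  refine mul_eq_zero_of_right _ ?_
  rw [show N + 2 - 1 = N + 1 by omega, mul_comm (geomSeries s),
    mul_comm (geomSeries s * geomSeries s), coeff_mul, coeff_mul,
    Finset.Nat.sum_antidiagonal_eq_sum_range_succ_mk,
    Finset.Nat.sum_antidiagonal_eq_sum_range_succ_mk] at h
  simp only [coeff_geomSeries_pow_succ, coeff_geomSeries, coeff_geomSeries_mul_self] at h
  have hsK : s ^ (K + 1) ≠ 0 := pow_ne_zero _ hs.ne'
  refine mul_left_cancel₀ hsK ?_
  rw [mul_zero, mul_sub, Finset.mul_sum, Finset.mul_sum, sub_eq_zero]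
  rw [Finset.mul_sum, Finset.mul_sum] at h
  convert h using 1
  · refine Finset.sum_congr rfl fun i hi => ?_
    obtain ⟨d, rfl⟩ := Nat.exists_eq_add_of_le (Finset.mem_range_succ_iff.mp hi)
    rw [Nat.add_sub_cancel_left]
    ring
  · refine Finset.sum_congr rfl fun i hi => ?_
    obtain ⟨d, rfl⟩ := Nat.exists_eq_add_of_le (Finset.mem_range_succ_iff.mp hi)
    rw [Nat.add_sub_cancel_left]
    push_cast
    ring

/-- Every maximizer of `h_k` on the nonnegative unit sphere is `(s, t, …, t)` up to order. -/
lemma exists_isMaxPair_of_max {n k : ℕ} (hk : 1 ≤ k) {a : Fin n → ℝ} (ha : a ∈ nonnegSphere n)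
    (H : ∀ b ∈ nonnegSphere n, completeHomog b k ≤ completeHomog a k) :
    ∃ (s t : ℝ) (σ : Equiv.Perm (Fin n)), IsMaxPair n k s t ∧ a = headVec n s t ∘ σ := by
  obtain ⟨K, rfl⟩ := Nat.exists_eq_add_of_le' hk
  obtain ⟨i, t, ht, hti, hall, hcrit⟩ := shape_of_max ha H
  have hs : 0 < a i := ht.trans_le hti
  have hn : 0 < n := i.pos
  have hG : ∏ l, geomSeries (a l) = geomSeries (a i) * geomSeries t ^ (n - 1) := by
    rw [← Finset.mul_prod_erase _ _ (Finset.mem_univ i),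
      Finset.prod_congr rfl fun l hl => congrArg geomSeries (hall l (Finset.ne_of_mem_erase hl)),
      Finset.prod_const, Finset.card_erase_of_mem (Finset.mem_univ i), Finset.card_univ,
      Fintype.card_fin]
  refine ⟨a i, t, Equiv.swap i ⟨0, hn⟩, ⟨ht, hti, ?_, fun h2 => ?_⟩, ?_⟩
  · have h := ha.2
    rw [← Finset.add_sum_erase _ _ (Finset.mem_univ i),
      Finset.sum_congr rfl fun l hl => by rw [hall l (Finset.ne_of_mem_erase hl)],
      Finset.sum_const, Finset.card_erase_of_mem (Finset.mem_univ i), Finset.card_univ,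
      Fintype.card_fin, nsmul_eq_mul, Nat.cast_sub hn, Nat.cast_one] at h
    exact h
  · refine isRoot_ratioPoly h2 hs ?_
    obtain ⟨j, hj⟩ : ∃ j, j ≠ i := by
      have : Nontrivial (Fin n) := Fin.nontrivial_iff_two_le.mpr h2
      exact exists_ne i
    have hc := hcrit j hj
    rw [hall j hj, hG] at hc
    rcases hc with hc | hc
    · have g1 := one_sub_mul_geomSeries (a i)
      have g2 := one_sub_mul_geomSeries t
      have e := one_sub_add_mul_geomSeries (a i) t (geomSeries (a i) * geomSeries t ^ (n - 1))
      obtain ⟨N, rfl⟩ := Nat.exists_eq_add_of_le' h2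
      rw [show N + 2 - 1 = N + 1 by omega] at *
      have e' : C (a i) * (geomSeries (a i) * geomSeries t ^ (N + 2))
          - C t * (geomSeries (a i) * geomSeries (a i) * geomSeries t ^ (N + 1))
          = C (a i - t) * (geomSeries (a i) * geomSeries t ^ (N + 1)
            - pairTerm (geomSeries (a i) * geomSeries t ^ (N + 1)) (a i) t) := by
        rw [← e]
        simp only [map_sub, map_add]
        linear_combination -(C (a i) * geomSeries (a i) * geomSeries t ^ (N + 2)) * g1
          + (C t * geomSeries (a i) * geomSeries (a i) * geomSeries t ^ (N + 1)) * g2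
      have h3 := congrArg (coeff K) e'
      rw [map_sub, coeff_C_mul, coeff_C_mul, coeff_C_mul, map_sub, hc, sub_self, mul_zero] at h3
      linarith
    · rw [← hc]
      congr 2
      rw [mul_assoc, ← pow_succ', ← pow_succ', ← pow_succ', Nat.sub_add_cancel (Nat.one_le_of_lt h2)]
  · ext l
    simp only [Function.comp, headVec]
    by_cases hl : l = i
    · simp [hl]
    · rw [hall l hl, if_neg]
      intro h0
      have h1 : Equiv.swap i ⟨0, hn⟩ l = ⟨0, hn⟩ := Fin.ext h0
      exact hl ((Equiv.swap i ⟨0, hn⟩).injective (h1.trans (Equiv.swap_apply_left i _).symm))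

lemma exists_isMaxPair {n : ℕ} (hn : 1 ≤ n) (k : ℕ) :
    ∃ s t : ℝ, IsMaxPair n k s t ∧ headVec n s t ∈ nonnegSphere n ∧
      ∀ b ∈ nonnegSphere n, completeHomog b k ≤ completeHomog (headVec n s t) k := by
  rcases Nat.eq_zero_or_pos k with rfl | hk
  · have hn0 : (0 : ℝ) < n := by exact_mod_cast hn
    have e : headVec n (1 / √(n : ℝ)) (1 / √(n : ℝ)) = fun _ => 1 / √(n : ℝ) := by
      ext; simp [headVec]
    refine ⟨1 / √(n : ℝ), 1 / √(n : ℝ), ⟨by positivity, le_rfl, ?_, fun _ => ?_⟩, ?_, ?_⟩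
    · rw [div_pow, Real.sq_sqrt hn0.le]
      field_simp
      ring
    · simp [ratioPoly]
    · rw [e]; exact const_mem_nonnegSphere hn
    · intro b _
      rw [completeHomog, completeHomog, coeff_zero_prod_geomSeries, coeff_zero_prod_geomSeries]
  · obtain ⟨a, ha, hmax⟩ := (isCompact_nonnegSphere n).exists_isMaxOn
      ⟨_, const_mem_nonnegSphere hn⟩ (continuous_completeHomog n k).continuousOn
    have H : ∀ b ∈ nonnegSphere n, completeHomog b k ≤ completeHomog a k := fun b hb => hmax hb
    obtain ⟨s, t, σ, hp, rfl⟩ := exists_isMaxPair_of_max hk ha H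
    rw [completeHomog_comp_perm] at H
    exact ⟨s, t, hp, mem_nonnegSphere_comp_perm σ ha, H⟩

theorem mainTheorem5 (n k : ℕ) (hn : 1 ≤ n) :
    (∀ (Ω : Type*) [MeasurableSpace Ω] (μ : Measure Ω) [IsProbabilityMeasure μ]
        (X : Fin n → Ω → ℝ), IsIIDStdExp X μ →
      (∀ a : Fin n → ℝ, Integrable (fun ω => (∑ i, a i * X i ω) ^ k) μ) ∧
      (∀ a ∈ nonnegSphere n,
        (Finset.Icc 1 n).inf' (Finset.nonempty_Icc.mpr hn) (fun m => rho m k)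
          ≤ linMoment X μ k a) ∧
      (1 ≤ k → ∀ a ∈ nonnegSphere n, IsMaxOn (linMoment X μ k) (nonnegSphere n) a →
        ∃ (s t : ℝ) (σ : Equiv.Perm (Fin n)), IsMaxPair n k s t ∧ a = headVec n s t ∘ σ)) ∧
    (∃ s t : ℝ, IsMaxPair n k s t ∧ headVec n s t ∈ nonnegSphere n ∧
      ∀ (Ω : Type*) [MeasurableSpace Ω] (μ : Measure Ω) [IsProbabilityMeasure μ]
        (X : Fin n → Ω → ℝ), IsIIDStdExp X μ →
        IsMaxOn (linMoment X μ k) (nonnegSphere n) (headVec n s t)) := by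
  have hk0 : (0 : ℝ) < k.factorial := by exact_mod_cast k.factorial_pos
  refine ⟨fun Ω _ μ _ X hX => ⟨fun a => (hX.moment_sum a Finset.univ k).1, fun a ha => ?_,
    fun hk a ha hmax => exists_isMaxPair_of_max hk ha fun b hb => ?_⟩, ?_⟩
  · obtain ⟨m, hm, hle⟩ := exists_equal_le_completeHomog hn k ha
    refine (Finset.inf'_le _ hm).trans ?_
    rw [rho_eq, hX.linMoment_eq]
    gcongr
  · have h : linMoment X μ k b ≤ linMoment X μ k a := hmax hb
    rw [hX.linMoment_eq, hX.linMoment_eq] at h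
    exact le_of_mul_le_mul_left h hk0
  · obtain ⟨s, t, hp, hmem, H⟩ := exists_isMaxPair hn k
    refine ⟨s, t, hp, hmem, fun Ω _ μ _ X hX b hb => ?_⟩
    simp only [Set.mem_ofPred_eq, hX.linMoment_eq]
    gcongr
    exact H b hb
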